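/- For a positive integer $n$, let $\|n\|$ be the integer complexity of $n$, the least number of $1$'s needed to write $n$ using any combination of addition, multiplication and parentheses. For $k\ge1$ let $E(k)$ be the largest $n$ with $\|n\|\le k$; for $n\ge1$ let $L(n)$ be the largest $k\ge1$ with $E(k)\le n$, and let $D(n)=\|n\|-L(n)$ be the integer defect of $n$. For $r\ge0$ and a residue class $a$ modulo $3$, define $h_{r,a}\in\mathbb{Q}$ and $K_{r,a}\in\mathbb{N}$ by the following tables, and for $k\geq 1$ write $h_{r,k}=h_{r,k\bmod 3}$ and $K_{r,k}=K_{r,k\bmod 3}$. For $a=0$: the pairs $(h_{r,0},K_{r,0})$ for $r=0,1,\dots,10$ are, in order, $$(1,3),\ (\tfrac{8}{9},6),\ (\tfrac{64}{81},12),\ (\tfrac{7}{9},12),\ (\tfrac{20}{27},12),\ (\tfrac{19}{27},12),\ (\tfrac{512}{729},18),\ (\tfrac{56}{81},18),\ (\tfrac{55}{81},18),\ (\tfrac{164}{243},18),\ (\tfrac{163}{243},18),$$ and for every $m\ge6$, $$(h_{2m-1,0},K_{2m-1,0})=\left(\tfrac23+\tfrac{2}{3^m},\,3m\right),\qquad (h_{2m,0},K_{2m,0})=\left(\tfrac23+\tfrac{1}{3^m},\,3m\right).$$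 For $a=2$: the pairs $(h_{r,2},K_{r,2})$ for $r=0,1,\dots,14$ are, in order, $$(1,2),\ (\tfrac{8}{9},8),\ (\tfrac{5}{6},8),\ (\tfrac{64}{81},14),\ (\tfrac{7}{9},14),\ (\tfrac{20}{27},14),\ (\tfrac{13}{18},14),\ (\tfrac{19}{27},14),$$ $$(\tfrac{512}{729},20),\ (\tfrac{56}{81},20),\ (\tfrac{37}{54},20),\ (\tfrac{55}{81},20),\ (\tfrac{164}{243},20),\ (\tfrac{109}{162},20),\ (\tfrac{163}{243},20),$$ and for every $m\ge6$, $$(h_{3m-3,2},K_{3m-3,2})=\left(\tfrac23+\tfrac{2}{3^m},\,3m+2\right),\quad (h_{3m-2,2},K_{3m-2,2})=\left(\tfrac23+\tfrac{1}{2\cdot3^{m-1}},\,3m+2\right),\quad (h_{3m-1,2},K_{3m-1,2})=\left(\tfrac23+\tfrac{1}{3^m},\,3m+2\right).$$ For $a=1$: the pairs $(h_{r,1},K_{r,1})$ for $r=0,1,\dots,5$ are, in order, $$(1,4),\ (\tfrac{8}{9},10),\ (\tfrac{5}{6},10),\ (\tfrac{64}{81},16),\ (\tfrac{7}{9},16),\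 (\tfrac{41}{54},16),$$ and for every $m\ge4$, $$(h_{m+2,1},K_{m+2,1})=\left(\tfrac34+\tfrac{1}{4\cdot3^m},\,3m+4\right).$$ Then a positive integer $n$ satisfies $D(n)\le1$ if and only if there exist integers $\ell\ge0$, $k\ge1$ and $r\ge0$ such that $k\ge K_{r,k}$ and $3^\ell n=h_{r,k}E(k)$. -/

import Mathlib

namespace IntegerComplexity

/-- Expressions built from the constant `1` by addition and multiplication, with arbitrary
parenthesization. -/
inductive OnesExpr : Type where
  | one : OnesExpr
  | add : OnesExpr → OnesExpr → OnesExpr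
  | mul : OnesExpr → OnesExpr → OnesExpr

/-- The natural number that an expression denotes. -/
def OnesExpr.value : OnesExpr → ℕ
  | .one => 1
  | .add a b => a.value + b.value
  | .mul a b => a.value * b.value

/-- The number of `1`'s that occur in an expression. -/
def OnesExpr.ones : OnesExpr → ℕ
  | .one => 1
  | .add a b => a.ones + b.ones
  | .mul a b => a.ones + b.ones

/-- The integer complexity `‖n‖` of a positive integer `n`: the least number of `1`'s in an
expression for `n`. (No expression denotes `0`.) -/
noncomputable def complexity (n : ℕ) : ℕ :=
  sInf {c | ∃ e : OnesExpr, e.value = n ∧ e.ones = c}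

/-- `E k`, for `k ≥ 1`: the largest positive integer of complexity at most `k`. -/
noncomputable def E (k : ℕ) : ℕ :=
  sSup {n | 0 < n ∧ complexity n ≤ k}

/-- `L n`, for `n ≥ 1`: the largest `k ≥ 1` with `E k ≤ n`. -/
noncomputable def L (n : ℕ) : ℕ :=
  sSup {k | 1 ≤ k ∧ E k ≤ n}

/-- The integer defect `D n = ‖n‖ - L n` of a positive integer `n`. -/
noncomputable def D (n : ℕ) : ℤ :=
  (complexity n : ℤ) - (L n : ℤ)

/-! The extrema in the definitions above are attained. -/

theorem OnesExpr.ones_pos (e : OnesExpr) : 1 ≤ e.ones := by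
  induction e with
  | one => exact le_rfl
  | add a b ha hb => simp only [OnesExpr.ones]; omega
  | mul a b ha hb => simp only [OnesExpr.ones]; omega

theorem OnesExpr.value_le (e : OnesExpr) : e.value ≤ 2 ^ e.ones := by
  induction e with
  | one => simp [OnesExpr.value, OnesExpr.ones]
  | add a b ha hb =>
    simp only [OnesExpr.value, OnesExpr.ones, pow_add]
    have h1 : 2 ^ 1 ≤ 2 ^ a.ones := Nat.pow_le_pow_right (by norm_num) a.ones_pos
    have h2 : 2 ^ 1 ≤ 2 ^ b.ones := Nat.pow_le_pow_right (by norm_num) b.ones_pos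
    nlinarith
  | mul a b ha hb =>
    simp only [OnesExpr.value, OnesExpr.ones, pow_add]
    exact Nat.mul_le_mul ha hb

theorem exists_value_ones (n : ℕ) : ∃ e : OnesExpr, e.value = n + 1 ∧ e.ones = n + 1 := by
  induction n with
  | zero => exact ⟨.one, rfl, rfl⟩
  | succ n ih =>
    obtain ⟨e, h1, h2⟩ := ih
    exact ⟨.add e .one, by simp [OnesExpr.value, h1], by simp [OnesExpr.ones, h2]⟩

theorem isLeast_complexity {n : ℕ} (hn : 0 < n) :
    IsLeast {c | ∃ e : OnesExpr, e.value = n ∧ e.ones = c} (complexity n) := by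
  obtain ⟨m, rfl⟩ : ∃ m, n = m + 1 := ⟨n - 1, by omega⟩
  obtain ⟨e, h1, h2⟩ := exists_value_ones m
  exact ⟨Nat.sInf_mem ⟨_, e, h1, h2⟩, fun c hc => Nat.sInf_le hc⟩

theorem complexity_le_self {n : ℕ} (hn : 0 < n) : complexity n ≤ n := by
  obtain ⟨m, rfl⟩ : ∃ m, n = m + 1 := ⟨n - 1, by omega⟩
  exact (isLeast_complexity hn).2 (exists_value_ones m)

theorem isGreatest_E {k : ℕ} (hk : 1 ≤ k) :
    IsGreatest {n | 0 < n ∧ complexity n ≤ k} (E k) := by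
  have hb : BddAbove {n | 0 < n ∧ complexity n ≤ k} := by
    refine ⟨2 ^ k, fun n hn => ?_⟩
    obtain ⟨e, h1, h2⟩ := (isLeast_complexity hn.1).1
    rw [← h1]
    exact e.value_le.trans (Nat.pow_le_pow_right (by norm_num) (h2 ▸ hn.2))
  exact ⟨Nat.sSup_mem ⟨k, hk, complexity_le_self hk⟩ hb, fun n hn => le_csSup hb hn⟩

theorem E_one : E 1 = 1 := by
  obtain ⟨hpos, hc⟩ := (isGreatest_E le_rfl).1
  obtain ⟨e, h1, h2⟩ := (isLeast_complexity hpos).1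
  cases e with
  | one => exact h1.symm
  | add a b =>
    have := a.ones_pos
    have := b.ones_pos
    simp only [OnesExpr.ones] at h2
    omega
  | mul a b =>
    have := a.ones_pos
    have := b.ones_pos
    simp only [OnesExpr.ones] at h2
    omega

theorem isGreatest_L {n : ℕ} (hn : 0 < n) :
    IsGreatest {k | 1 ≤ k ∧ E k ≤ n} (L n) := by
  have hb : BddAbove {k | 1 ≤ k ∧ E k ≤ n} :=
    ⟨n, fun k hk => ((isGreatest_E hk.1).2 ⟨hk.1, complexity_le_self hk.1⟩).trans hk.2⟩
  exact ⟨Nat.sSup_mem ⟨1, le_rfl, by rw [E_one]; exact hn⟩ hb, fun k hk => le_csSup hb hk⟩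

/-! The generalized Rawsthorne tables. Row `r` of the table for the residue class `a` modulo `3`
is the pair `(h_{r,a}, K_{r,a})`. -/

/-- The table for `k ≡ 0 (mod 3)`. With `n = m / 2 + 6`, the last line covers the rows
`r = 2 n - 1` (`m` even) and `r = 2 n` (`m` odd) for all `n ≥ 6`. -/
def table0 : ℕ → ℚ × ℕ
  | 0 => (1, 3)
  | 1 => (8 / 9, 6)
  | 2 => (64 / 81, 12)
  | 3 => (7 / 9, 12)
  | 4 => (20 / 27, 12)
  | 5 => (19 / 27, 12)
  | 6 => (512 / 729, 18)
  | 7 => (56 / 81, 18)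
  | 8 => (55 / 81, 18)
  | 9 => (164 / 243, 18)
  | 10 => (163 / 243, 18)
  | m + 11 =>
    if m % 2 = 0 then (2 / 3 + 2 / 3 ^ (m / 2 + 6), 3 * (m / 2 + 6))
    else (2 / 3 + 1 / 3 ^ (m / 2 + 6), 3 * (m / 2 + 6))

/-- The table for `k ≡ 2 (mod 3)`. With `n = m / 3 + 6`, the last line covers the rows
`r = 3 n - 3`, `r = 3 n - 2` and `r = 3 n - 1` (`m ≡ 0, 1, 2` modulo `3`) for all `n ≥ 6`. -/
def table2 : ℕ → ℚ × ℕ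
  | 0 => (1, 2)
  | 1 => (8 / 9, 8)
  | 2 => (5 / 6, 8)
  | 3 => (64 / 81, 14)
  | 4 => (7 / 9, 14)
  | 5 => (20 / 27, 14)
  | 6 => (13 / 18, 14)
  | 7 => (19 / 27, 14)
  | 8 => (512 / 729, 20)
  | 9 => (56 / 81, 20)
  | 10 => (37 / 54, 20)
  | 11 => (55 / 81, 20)
  | 12 => (164 / 243, 20)
  | 13 => (109 / 162, 20)
  | 14 => (163 / 243, 20)
  | m + 15 =>
    if m % 3 = 0 then (2 / 3 + 2 / 3 ^ (m / 3 + 6), 3 * (m / 3 + 6) + 2)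
    else if m % 3 = 1 then (2 / 3 + 1 / (2 * 3 ^ (m / 3 + 5)), 3 * (m / 3 + 6) + 2)
    else (2 / 3 + 1 / 3 ^ (m / 3 + 6), 3 * (m / 3 + 6) + 2)

/-- The table for `k ≡ 1 (mod 3)`, `k > 1`. With `n = m + 4`, the last line covers the rows
`r = n + 2` for all `n ≥ 4`. -/
def table1 : ℕ → ℚ × ℕ
  | 0 => (1, 4)
  | 1 => (8 / 9, 10)
  | 2 => (5 / 6, 10)
  | 3 => (64 / 81, 16)
  | 4 => (7 / 9, 16)
  | 5 => (41 / 54, 16)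
  | m + 6 => (3 / 4 + 1 / (4 * 3 ^ (m + 4)), 3 * (m + 4) + 4)

/-- Row `r` of the table for the residue class of `k` modulo `3`. -/
def tableRow (r k : ℕ) : ℚ × ℕ :=
  if k % 3 = 0 then table0 r else if k % 3 = 1 then table1 r else table2 r

/-- The coefficient `h_{r,k}`, which depends on `k` only modulo `3`. -/
def h (r k : ℕ) : ℚ := (tableRow r k).1

/-- The threshold `K_{r,k}`, which depends on `k` only modulo `3`. -/
def K (r k : ℕ) : ℕ := (tableRow r k).2

end IntegerComplexity

namespace IntegerComplexity

/-! Call a value `n` of an expression with `k` ones a top value if `n > E (k - 1)`, with `E 0` read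
as `1`. For `n > 1`, `D n ≤ 1` says that `n` is a top value for `k = ‖n‖`: it means `E (‖n‖ - 1) ≤
n`, and equality would lower the complexity.

The explicit formula for `E` makes it supermultiplicative, so the factors of a top value are top
values. It also gives `E i + E j ≤ E (i + j - 1)` for `i, j ≥ 2`, apart from the sums `2 + 2` and `2
+ 3`, so a top value that is a sum is some `E (k - 1) + 1`. Hence every top value is a product of
twos, threes and core values `E (k - 1) + 1` (`OnesExpr.shape`). Two core values never fit together
(`Core.mul_le`), and only boundedly many twos fit (`Core.listed`, `le_ten_of_maxValue_lt`). What
remains is a power of `3` times a number in `Listed`.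

Conversely, a listed number is at least `E (i - 1)` for its number `i` of ones, and this survives
multiplication by `3` (`Listed.D_le_one`). The tables are the same list divided by `E k`, so the
theorem follows by matching rows with listed numbers in both directions. -/

/-! ### The largest value of an expression with `k` ones -/

/-- An explicit formula for `E k`, `k ≥ 1`. -/
def maxValue : ℕ → ℕ
  | 0 => 1
  | 1 => 1
  | 2 => 2
  | 3 => 3
  | 4 => 4
  | k + 5 => 3 * maxValue (k + 2)

theorem maxValue_add_five (k : ℕ) : maxValue (k + 5) = 3 * maxValue (k + 2) := by
  rw [maxValue]

/-- The exception is `2 * 2 > 3 * 1`. The value `1` at index `0` is the empty product, which lets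
the recursion start there. -/
theorem maxValue_add_three {k : ℕ} (hk : k ≠ 1) : maxValue (k + 3) = 3 * maxValue k := by
  match k, hk with
  | 0, _ => rfl
  | k + 2, _ => exact maxValue_add_five k

theorem maxValue_add_three_mul {k : ℕ} (hk : k ≠ 1) (i : ℕ) :
    maxValue (k + 3 * i) = 3 ^ i * maxValue k := by
  induction i with
  | zero => simp
  | succ i ih =>
    rw [show k + 3 * (i + 1) = (k + 3 * i) + 3 by ring, maxValue_add_three (by omega), ih]
    ring

theorem maxValue_three_mul (q : ℕ) : maxValue (3 * q) = 3 ^ q := by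
  have := maxValue_add_three_mul (k := 0) (by norm_num) q
  simpa [maxValue] using this

theorem maxValue_three_mul_add_two (q : ℕ) : maxValue (3 * q + 2) = 2 * 3 ^ q := by
  rw [add_comm, maxValue_add_three_mul (by norm_num) q, mul_comm]
  rfl

theorem maxValue_three_mul_add_four (q : ℕ) : maxValue (3 * q + 4) = 4 * 3 ^ q := by
  rw [add_comm, maxValue_add_three_mul (by norm_num) q, mul_comm]
  rfl

theorem maxValue_pos (k : ℕ) : 0 < maxValue k := by
  induction k using Nat.strong_induction_on with
  | _ k ih =>
    match k with
    | 0 | 1 | 2 | 3 | 4 => decide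
    | k + 5 =>
      rw [maxValue_add_five]
      have := ih (k + 2) (by omega)
      omega

theorem maxValue_mul_le (i j : ℕ) : maxValue i * maxValue j ≤ maxValue (i + j) := by
  induction hs : i + j using Nat.strong_induction_on generalizing i j with
  -- An index that is at least `5` stays at least `2` after lowering it by `3`, so the exceptional
  -- index `1` is never reached.
  | _ s ih =>
    subst hs
    rcases lt_or_ge i 5 with hi | hi
    · rcases lt_or_ge j 5 with hj | hj
      · interval_cases i <;> interval_cases j <;> decide
      · obtain ⟨j, rfl⟩ := Nat.exists_eq_add_of_le' hj
        have := ih (i + (j + 2)) (by omega) i (j + 2) rfl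
        rw [maxValue_add_five, show i + (j + 5) = i + (j + 2) + 3 by ring,
          maxValue_add_three (by omega)]
        linarith
    · obtain ⟨i, rfl⟩ := Nat.exists_eq_add_of_le' hi
      have := ih (i + 2 + j) (by omega) (i + 2) j rfl
      rw [maxValue_add_five, show i + 5 + j = i + 2 + j + 3 by ring,
        maxValue_add_three (by omega)]
      linarith

theorem maxValue_add_le {i j : ℕ} (hi : 1 ≤ i) (hj : 1 ≤ j) :
    maxValue i + maxValue j ≤ maxValue (i + j) := by
  induction hs : i + j using Nat.strong_induction_on generalizing i j with
  | _ s ih =>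
    subst hs
    rcases lt_or_ge i 5 with hi' | hi'
    · rcases lt_or_ge j 5 with hj' | hj'
      · interval_cases i <;> interval_cases j <;> decide
      · obtain ⟨j, rfl⟩ := Nat.exists_eq_add_of_le' hj'
        have := ih (i + (j + 2)) (by omega) hi (j := j + 2) (by omega) rfl
        rw [maxValue_add_five, show i + (j + 5) = i + (j + 2) + 3 by ring,
          maxValue_add_three (by omega)]
        linarith
    · obtain ⟨i, rfl⟩ := Nat.exists_eq_add_of_le' hi'
      have := ih (i + 2 + j) (by omega) (i := i + 2) (by omega) hj rfl
      rw [maxValue_add_five, show i + 5 + j = i + 2 + j + 3 by ring,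
        maxValue_add_three (by omega)]
      linarith

/-- Adding two parts of at least two ones wastes a one. The bound on `i + j` excludes exactly `2 + 2
> 3` and `2 + 3 > 4`. -/
theorem maxValue_add_le_pred {i j : ℕ} (hij : 2 ≤ i + j) :
    maxValue (i + 2) + maxValue (j + 2) ≤ maxValue (i + j + 3) := by
  induction hs : i + j using Nat.strong_induction_on generalizing i j with
  | _ s ih =>
    subst hs
    rcases lt_or_ge (i + j) 5 with h5 | h5
    · have hi : i < 5 := by omega
      have hj : j < 5 := by omega
      interval_cases i <;> interval_cases j <;> first | omega | decide
    · rcases le_or_gt 3 i with hi | hi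
      · obtain ⟨i, rfl⟩ := Nat.exists_eq_add_of_le' hi
        have := ih (i + j) (by omega) (i := i) (j := j) (by omega) rfl
        rw [show i + 3 + j + 3 = i + j + 3 + 3 by ring, maxValue_add_three (by omega),
          maxValue_add_five]
        linarith
      · obtain ⟨j, rfl⟩ := Nat.exists_eq_add_of_le' (show 3 ≤ j by omega)
        have := ih (i + j) (by omega) (i := i) (j := j) (by omega) rfl
        rw [show i + (j + 3) + 3 = i + j + 3 + 3 by ring, maxValue_add_three (by omega),
          maxValue_add_five]
        linarith

theorem maxValue_mono : Monotone maxValue := by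
  refine monotone_nat_of_le_succ fun k => ?_
  rcases Nat.eq_zero_or_pos k with rfl | hk
  · decide
  · exact (Nat.le_add_right _ _).trans (maxValue_add_le hk le_rfl)

theorem OnesExpr.value_le_maxValue (e : OnesExpr) : e.value ≤ maxValue e.ones := by
  induction e with
  | one => decide
  | add a b ha hb => exact (Nat.add_le_add ha hb).trans (maxValue_add_le a.ones_pos b.ones_pos)
  | mul a b ha hb => exact (Nat.mul_le_mul ha hb).trans (maxValue_mul_le _ _)

/-! ### Complexity bounds and the explicit value of `E`. -/

theorem complexity_value_le (e : OnesExpr) (he : 0 < e.value) : complexity e.value ≤ e.ones :=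
  (isLeast_complexity he).2 ⟨e, rfl, rfl⟩

theorem complexity_mul_le {m n : ℕ} (hm : 0 < m) (hn : 0 < n) :
    complexity (m * n) ≤ complexity m + complexity n := by
  obtain ⟨e, rfl, he⟩ := (isLeast_complexity hm).1
  obtain ⟨f, rfl, hf⟩ := (isLeast_complexity hn).1
  rw [← he, ← hf]
  exact complexity_value_le (.mul e f) (Nat.mul_pos hm hn)

theorem complexity_add_le {m n : ℕ} (hm : 0 < m) (hn : 0 < n) :
    complexity (m + n) ≤ complexity m + complexity n := by
  obtain ⟨e, rfl, he⟩ := (isLeast_complexity hm).1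
  obtain ⟨f, rfl, hf⟩ := (isLeast_complexity hn).1
  rw [← he, ← hf]
  exact complexity_value_le (.add e f) (Nat.add_pos_left hm _)

theorem complexity_one_le : complexity 1 ≤ 1 := complexity_le_self one_pos

theorem complexity_maxValue_le {k : ℕ} (hk : 1 ≤ k) : complexity (maxValue k) ≤ k := by
  induction k using Nat.strong_induction_on with
  | _ k ih =>
    match k with
    | 1 | 2 | 3 | 4 => exact complexity_le_self (by decide)
    | k + 5 =>
      rw [maxValue_add_five]
      have h1 := ih (k + 2) (by omega) (by omega)
      have h2 := complexity_mul_le (m := 3) (by norm_num) (maxValue_pos (k + 2))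
      have h3 := complexity_le_self (n := 3) (by norm_num)
      omega

theorem E_eq_maxValue {k : ℕ} (hk : 1 ≤ k) : E k = maxValue k := by
  refine (isGreatest_E hk).unique ⟨⟨maxValue_pos k, complexity_maxValue_le hk⟩, ?_⟩
  rintro n ⟨hn, hc⟩
  obtain ⟨e, rfl, he⟩ := (isLeast_complexity hn).1
  exact e.value_le_maxValue.trans (maxValue_mono (he ▸ hc))

/-! ### Numbers of integer defect at most one -/

theorem D_le_one_of_maxValue_le {n k : ℕ} (hn : 0 < n) (hc : complexity n ≤ k + 1)
    (hk : maxValue k ≤ n) : D n ≤ 1 := by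
  have hL : k ≤ L n := by
    rcases Nat.eq_zero_or_pos k with rfl | hk'
    · exact Nat.zero_le _
    · exact (isGreatest_L hn).2 ⟨hk', by rwa [E_eq_maxValue hk']⟩
  unfold D
  omega

/-- The inequality is strict because `E (‖n‖ - 1)` has complexity at most `‖n‖ - 1`, hence is not
`n`. -/
theorem maxValue_lt_of_D_le_one {n : ℕ} (hn : 1 < n) (hD : D n ≤ 1) :
    2 ≤ complexity n ∧ maxValue (complexity n - 1) < n := by
  have h0 : 0 < n := by omega
  have h2 : 2 ≤ complexity n := by
    obtain ⟨e, he, hc⟩ := (isLeast_complexity h0).1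
    by_contra hlt
    have h3 := e.value_le_maxValue.trans (maxValue_mono (show e.ones ≤ 1 by omega))
    have h4 : maxValue 1 = 1 := rfl
    omega
  refine ⟨h2, lt_of_le_of_ne ?_ fun heq => ?_⟩
  · obtain ⟨hL1, hL⟩ := (isGreatest_L h0).1
    rw [E_eq_maxValue hL1] at hL
    unfold D at hD
    exact (maxValue_mono (by omega)).trans hL
  · have := complexity_maxValue_le (k := complexity n - 1) (by omega)
    rw [heq] at this
    omega

/-! ### Core values and the shape of the top values. -/

/-- The values other than `2`, `3`, `4` of the form `E (k - 1) + 1`, with `k`. -/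
inductive Core : ℕ → ℕ → Prop
  | two_mul (m : ℕ) : Core (2 * 3 ^ (m + 1) + 1) (3 * m + 6)
  | four_mul (m : ℕ) : Core (4 * 3 ^ m + 1) (3 * m + 5)
  | one_mul (m : ℕ) : Core (3 ^ (m + 2) + 1) (3 * m + 7)

theorem Core.five_le {c k : ℕ} (h : Core c k) : 5 ≤ k := by
  cases h <;> omega

theorem Core.pred {c k : ℕ} (h : Core c k) : c = maxValue (k - 1) + 1 := by
  cases h with
  | two_mul m =>
    rw [show 3 * m + 6 - 1 = 3 * (m + 1) + 2 by omega, maxValue_three_mul_add_two]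
  | four_mul m =>
    rw [show 3 * m + 5 - 1 = 3 * m + 4 by omega, maxValue_three_mul_add_four]
  | one_mul m =>
    rw [show 3 * m + 7 - 1 = 3 * (m + 2) by omega, maxValue_three_mul]

/-- A product of two core values is never among the top values. -/
theorem Core.mul_le {c d i j : ℕ} (hc : Core c i) (hd : Core d j) :
    c * d ≤ maxValue (i + j - 1) := by
  cases hc with
  | two_mul m =>
    have hx : 1 ≤ 3 ^ m := Nat.one_le_pow _ _ (by norm_num)
    cases hd with
    | two_mul p =>
      have hy : 1 ≤ 3 ^ p := Nat.one_le_pow _ _ (by norm_num)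
      rw [show 3 * m + 6 + (3 * p + 6) - 1 = 3 * (m + p + 3) + 2 by omega,
        maxValue_three_mul_add_two]
      simp only [pow_add]
      nlinarith
    | four_mul p =>
      have hy : 1 ≤ 3 ^ p := Nat.one_le_pow _ _ (by norm_num)
      rw [show 3 * m + 6 + (3 * p + 5) - 1 = 3 * (m + p + 2) + 4 by omega,
        maxValue_three_mul_add_four]
      simp only [pow_add]
      nlinarith
    | one_mul p =>
      have hy : 1 ≤ 3 ^ p := Nat.one_le_pow _ _ (by norm_num)
      rw [show 3 * m + 6 + (3 * p + 7) - 1 = 3 * (m + p + 4) by omega, maxValue_three_mul]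
      simp only [pow_add]
      nlinarith
  | four_mul m =>
    have hx : 1 ≤ 3 ^ m := Nat.one_le_pow _ _ (by norm_num)
    cases hd with
    | two_mul p =>
      have hy : 1 ≤ 3 ^ p := Nat.one_le_pow _ _ (by norm_num)
      rw [show 3 * m + 5 + (3 * p + 6) - 1 = 3 * (m + p + 2) + 4 by omega,
        maxValue_three_mul_add_four]
      simp only [pow_add]
      nlinarith
    | four_mul p =>
      have hy : 1 ≤ 3 ^ p := Nat.one_le_pow _ _ (by norm_num)
      rw [show 3 * m + 5 + (3 * p + 5) - 1 = 3 * (m + p + 3) by omega, maxValue_three_mul]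
      simp only [pow_add]
      nlinarith
    | one_mul p =>
      have hy : 1 ≤ 3 ^ p := Nat.one_le_pow _ _ (by norm_num)
      rw [show 3 * m + 5 + (3 * p + 7) - 1 = 3 * (m + p + 3) + 2 by omega,
        maxValue_three_mul_add_two]
      simp only [pow_add]
      nlinarith
  | one_mul m =>
    have hx : 1 ≤ 3 ^ m := Nat.one_le_pow _ _ (by norm_num)
    cases hd with
    | two_mul p =>
      have hy : 1 ≤ 3 ^ p := Nat.one_le_pow _ _ (by norm_num)
      rw [show 3 * m + 7 + (3 * p + 6) - 1 = 3 * (m + p + 4) by omega, maxValue_three_mul]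
      simp only [pow_add]
      nlinarith
    | four_mul p =>
      have hy : 1 ≤ 3 ^ p := Nat.one_le_pow _ _ (by norm_num)
      rw [show 3 * m + 7 + (3 * p + 5) - 1 = 3 * (m + p + 3) + 2 by omega,
        maxValue_three_mul_add_two]
      simp only [pow_add]
      nlinarith
    | one_mul p =>
      have hy : 1 ≤ 3 ^ p := Nat.one_le_pow _ _ (by norm_num)
      rw [show 3 * m + 7 + (3 * p + 7) - 1 = 3 * (m + p + 3) + 4 by omega,
        maxValue_three_mul_add_four]
      simp only [pow_add]
      nlinarith

theorem two_pow_mul_three_pow_le_maxValue (a b : ℕ) :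
    2 ^ a * 3 ^ b ≤ maxValue (2 * a + 3 * b) := by
  have h2 : 2 ^ a ≤ maxValue (2 * a) := by
    induction a with
    | zero => decide
    | succ a ih =>
      calc 2 ^ (a + 1) = 2 ^ a * maxValue 2 := by rw [pow_succ]; rfl
        _ ≤ maxValue (2 * a) * maxValue 2 := Nat.mul_le_mul_right _ ih
        _ ≤ maxValue (2 * (a + 1)) := maxValue_mul_le _ _
  calc 2 ^ a * 3 ^ b ≤ maxValue (2 * a) * maxValue (3 * b) :=
        Nat.mul_le_mul h2 (maxValue_three_mul b).ge
    _ ≤ _ := maxValue_mul_le _ _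

/-- A factor of a top value is a top value. -/
theorem maxValue_pred_lt_of_mul {m n i j : ℕ} (hi : 1 ≤ i) (hn : n ≤ maxValue j)
    (h : maxValue (i + j - 1) < m * n) : maxValue (i - 1) < m := by
  by_contra! hle
  have h1 := (Nat.mul_le_mul hle hn).trans (maxValue_mul_le (i - 1) j)
  rw [show i - 1 + j = i + j - 1 by omega] at h1
  omega

/-- `n` is a product of twos, threes and at most one core value, with `k` ones in total. -/
def Shape (n k : ℕ) : Prop :=
  (∃ a b, n = 2 ^ a * 3 ^ b ∧ k = 2 * a + 3 * b) ∨
    ∃ a b c i, Core c i ∧ n = 2 ^ a * 3 ^ b * c ∧ k = 2 * a + 3 * b + i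

theorem Shape.mul {m n i j : ℕ} (hm : Shape m i) (hn : Shape n j)
    (h : maxValue (i + j - 1) < m * n) : Shape (m * n) (i + j) := by
  rcases hm with ⟨a, b, rfl, rfl⟩ | ⟨a, b, c, u, hc, rfl, rfl⟩ <;>
    rcases hn with ⟨a', b', rfl, rfl⟩ | ⟨a', b', d, v, hd, rfl, rfl⟩
  · exact .inl ⟨a + a', b + b', by ring, by ring⟩
  · exact .inr ⟨a + a', b + b', d, v, hd, by ring, by ring⟩
  · exact .inr ⟨a + a', b + b', c, u, hc, by ring, by ring⟩
  · have hu := hc.five_le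
    -- With two core values present, the twos and threes can be split off; `c * d` would then itself
    -- be a top value, against `Core.mul_le`.
    have h1 : maxValue (u + v - 1) < c * d := by
      refine maxValue_pred_lt_of_mul (by omega)
        (two_pow_mul_three_pow_le_maxValue (a + a') (b + b')) ?_
      rw [show u + v + (2 * (a + a') + 3 * (b + b')) - 1
        = 2 * a + 3 * b + u + (2 * a' + 3 * b' + v) - 1 by omega]
      convert h using 1
      ring
    exact absurd (hc.mul_le hd) (by omega)

theorem shape_maxValue_add_one {j : ℕ} (hj : 1 ≤ j) : Shape (maxValue j + 1) (j + 1) := by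
  obtain rfl | rfl | rfl | hj4 : j = 1 ∨ j = 2 ∨ j = 3 ∨ 4 ≤ j := by omega
  · exact .inl ⟨1, 0, rfl, rfl⟩
  · exact .inl ⟨0, 1, rfl, rfl⟩
  · exact .inl ⟨2, 0, rfl, rfl⟩
  · suffices h : Core (maxValue j + 1) (j + 1) from .inr ⟨0, 0, _, _, h, by ring, by ring⟩
    obtain ⟨m, rfl | rfl | rfl⟩ : ∃ m, j = 3 * m + 4 ∨ j = 3 * (m + 1) + 2 ∨ j = 3 * (m + 2) :=
      ⟨(j - 4) / 3, by omega⟩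
    · rw [maxValue_three_mul_add_four]
      exact .four_mul m
    · rw [maxValue_three_mul_add_two]
      exact .two_mul m
    · rw [maxValue_three_mul]
      exact .one_mul m

/-- Only products use the induction hypothesis: a sum that is a top value is `E j + 1` whatever its
summands look like. -/
theorem OnesExpr.shape (e : OnesExpr) (h2 : 2 ≤ e.ones) (h : maxValue (e.ones - 1) < e.value) :
    Shape e.value e.ones := by
  induction e with
  | one => simp [ones] at h2
  | add a b iha ihb =>
    simp only [ones, value] at h h2 ⊢
    have ha := a.value_le_maxValue
    have hb := b.value_le_maxValue
    have ha1 := a.ones_pos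
    have hb1 := b.ones_pos
    generalize a.ones = i at *
    generalize b.ones = j at *
    generalize a.value = x at *
    generalize b.value = y at *
    have e1 : maxValue 1 = 1 := rfl
    have e2 : maxValue 2 = 2 := rfl
    have e3 : maxValue 3 = 3 := rfl
    have e4 : maxValue 4 = 4 := rfl
    -- A summand with a single one is `1`, and the other summand must then be maximal.
    obtain rfl | rfl | ⟨hi, hj⟩ : i = 1 ∨ j = 1 ∨ (2 ≤ i ∧ 2 ≤ j) := by omega
    · rw [Nat.add_sub_cancel_left] at h
      rw [show x + y = maxValue j + 1 by omega, add_comm 1]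
      exact shape_maxValue_add_one hb1
    · rw [Nat.add_sub_cancel] at h
      rw [show x + y = maxValue i + 1 by omega]
      exact shape_maxValue_add_one ha1
    · obtain ⟨i, rfl⟩ := Nat.exists_eq_add_of_le' hi
      obtain ⟨j, rfl⟩ := Nat.exists_eq_add_of_le' hj
      rw [show i + 2 + (j + 2) - 1 = i + j + 3 by omega] at h
      -- Only `2 + 2 = E 3 + 1` and `2 + 3 = E 4 + 1` survive.
      have hlt : i + j < 2 := by
        by_contra! hge
        have := maxValue_add_le_pred hge
        omega
      obtain ⟨rfl, rfl⟩ | ⟨rfl, rfl⟩ | ⟨rfl, rfl⟩ :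
        (i = 0 ∧ j = 0) ∨ (i = 0 ∧ j = 1) ∨ (i = 1 ∧ j = 0) := by omega
      · simp only [Nat.zero_add] at *
        rw [show x + y = maxValue 3 + 1 by omega]
        exact shape_maxValue_add_one (by norm_num)
      · simp only [Nat.zero_add, Nat.reduceAdd] at *
        rw [show x + y = maxValue 4 + 1 by omega]
        exact shape_maxValue_add_one (by norm_num)
      · simp only [Nat.zero_add, Nat.reduceAdd] at *
        rw [show x + y = maxValue 4 + 1 by omega]
        exact shape_maxValue_add_one (by norm_num)
  | mul a b iha ihb =>
    simp only [ones, value] at h h2 ⊢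
    have ha := a.value_le_maxValue
    have hb := b.value_le_maxValue
    have ha1 := a.ones_pos
    have hb1 := b.ones_pos
    have ga := maxValue_pred_lt_of_mul ha1 hb h
    have gb := maxValue_pred_lt_of_mul hb1 ha
      (by rwa [add_comm b.ones, mul_comm b.value])
    -- A factor with a single one is `1`, which does not exceed `maxValue 0 = 1`.
    have key : ∀ {c : OnesExpr}, 1 ≤ c.ones → maxValue (c.ones - 1) < c.value → 2 ≤ c.ones := by
      intro c h1 hc
      by_contra hlt
      have h3 := c.value_le_maxValue
      have h1 : c.ones = 1 := by omega
      rw [h1] at h3 hc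
      have e1 : maxValue 1 = 1 := rfl
      have e0 : maxValue (1 - 1) = 1 := rfl
      omega
    exact (iha (key ha1 ga) ga).mul (ihb (key hb1 gb) gb) h

/-! ### Bounding the number of factors two. -/

/-- The numbers prime to `3` among the top values, with their number of ones. -/
inductive Listed : ℕ → ℕ → Prop
  | pow (j : ℕ) (hj : j ≤ 10) : Listed (2 ^ j) (2 * j)
  | two_mul (j m : ℕ) (hj : j ≤ 1) : Listed (2 ^ j * (2 * 3 ^ (m + 1) + 1)) (2 * j + (3 * m + 6))
  | four_mul (m : ℕ) : Listed (4 * 3 ^ m + 1) (3 * m + 5)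
  | one_mul (j m : ℕ) (hj : j ≤ 2) : Listed (2 ^ j * (3 ^ (m + 2) + 1)) (2 * j + (3 * m + 7))

/-- `2 ^ 11 = 2048` does not exceed `E 21 = 3 ^ 7 = 2187`, and a larger power of two would have it
as a factor. -/
theorem le_ten_of_maxValue_lt {a : ℕ} (ha : 1 ≤ a) (h : maxValue (2 * a - 1) < 2 ^ a) :
    a ≤ 10 := by
  by_contra! hlt
  obtain ⟨t, rfl⟩ := Nat.exists_eq_add_of_le' (show 11 ≤ a by omega)
  have h1 : maxValue (2 * 11 - 1) < 2 ^ 11 := by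
    have h2 := two_pow_mul_three_pow_le_maxValue t 0
    rw [pow_zero, mul_one, mul_zero, add_zero] at h2
    refine maxValue_pred_lt_of_mul (by norm_num) h2 ?_
    rwa [show 2 * 11 + 2 * t - 1 = 2 * (t + 11) - 1 by omega, ← pow_add, add_comm 11]
  exact absurd h1 (by decide)

/-- Powers of two beyond `2 ^ s` do not fit if `2 ^ s` does not. -/
theorem lt_of_maxValue_lt {a s c i : ℕ} (hi : 1 ≤ i) (h : maxValue (2 * a + i - 1) < 2 ^ a * c)
    (hs : 2 ^ s * c ≤ maxValue (2 * s + i - 1)) : a < s := by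
  by_contra! hlt
  obtain ⟨t, rfl⟩ := Nat.exists_eq_add_of_le' hlt
  have h2 := two_pow_mul_three_pow_le_maxValue t 0
  rw [pow_zero, mul_one, mul_zero, add_zero] at h2
  refine absurd (maxValue_pred_lt_of_mul (m := 2 ^ s * c) (i := 2 * s + i) (by omega) h2 ?_)
    (not_lt.2 hs)
  rw [show 2 * s + i + 2 * t - 1 = 2 * (t + s) + i - 1 by omega]
  convert h using 1
  ring

theorem Core.listed {a c i : ℕ} (hc : Core c i) (h : maxValue (2 * a + i - 1) < 2 ^ a * c) :
    Listed (2 ^ a * c) (2 * a + i) := by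
  cases hc with
  | two_mul m =>
    rcases Nat.eq_zero_or_pos m with rfl | hm
    · have ha : a < 5 := lt_of_maxValue_lt (by omega) h (by decide)
      obtain hj | ⟨j, hj, rfl⟩ : a ≤ 1 ∨ ∃ j ≤ 2, a = j + 2 :=
        (le_or_gt a 1).imp_right fun _ => ⟨a - 2, by omega, by omega⟩
      · exact .two_mul a 0 hj
      -- `4 * 7 = 3 ^ 3 + 1`.
      · convert Listed.one_mul j 1 hj using 1 <;> ring
    · have ha : a < 2 := by
        refine lt_of_maxValue_lt (by omega) h ?_
        rw [show 2 * 2 + (3 * m + 6) - 1 = 3 * (m + 3) by omega, maxValue_three_mul]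
        have : 3 ^ 1 ≤ 3 ^ m := Nat.pow_le_pow_right (by norm_num) hm
        simp only [pow_add]
        omega
      exact .two_mul a m (by omega)
  | four_mul m =>
    rcases Nat.eq_zero_or_pos m with rfl | hm
    · have ha : a < 4 := lt_of_maxValue_lt (by omega) h (by decide)
      rcases a with _ | j
      · convert Listed.four_mul 0 using 1
        ring
      -- `2 * 5 = 3 ^ 2 + 1`.
      · convert Listed.one_mul j 0 (by omega) using 1 <;> ring
    · have ha : a < 1 := by
        refine lt_of_maxValue_lt (by omega) h ?_
        rw [show 2 * 1 + (3 * m + 5) - 1 = 3 * (m + 2) by omega, maxValue_three_mul]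
        have : 3 ^ 1 ≤ 3 ^ m := Nat.pow_le_pow_right (by norm_num) hm
        simp only [pow_add]
        omega
      obtain rfl : a = 0 := by omega
      convert Listed.four_mul m using 1 <;> ring
  | one_mul m =>
    have ha : a < 3 := by
      refine lt_of_maxValue_lt (by omega) h ?_
      rw [show 2 * 3 + (3 * m + 7) - 1 = 3 * (m + 4) by omega, maxValue_three_mul]
      have : 1 ≤ 3 ^ m := Nat.one_le_pow _ _ (by norm_num)
      simp only [pow_add]
      omega
    exact .one_mul a m (by omega)

theorem Shape.exists_listed {n k : ℕ} (hk : 2 ≤ k) (hs : Shape n k) (h : maxValue (k - 1) < n) :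
    ∃ c i b, Listed c i ∧ n = 3 ^ b * c := by
  rcases hs with ⟨a, b, rfl, rfl⟩ | ⟨a, b, c, i, hc, rfl, rfl⟩
  · refine ⟨2 ^ a, 2 * a, b, .pow a ?_, mul_comm _ _⟩
    rcases Nat.eq_zero_or_pos a with rfl | ha
    · norm_num
    · exact le_ten_of_maxValue_lt ha
        (maxValue_pred_lt_of_mul (by omega) (maxValue_three_mul b).ge h)
  · refine ⟨2 ^ a * c, 2 * a + i, b, hc.listed ?_, by ring⟩
    have := hc.five_le
    refine maxValue_pred_lt_of_mul (by omega) (maxValue_three_mul b).ge ?_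
    rw [show 2 * a + i + 3 * b - 1 = 2 * a + 3 * b + i - 1 by omega]
    convert h using 1
    ring

/-! ### Listed numbers have defect at most one. -/

theorem complexity_two_pow_mul_le {n : ℕ} (hn : 0 < n) (j : ℕ) :
    complexity (2 ^ j * n) ≤ 2 * j + complexity n := by
  induction j with
  | zero => simp
  | succ j ih =>
    have h1 := complexity_mul_le (m := 2) (n := 2 ^ j * n) (by norm_num) (by positivity)
    have h2 := complexity_le_self (n := 2) (by norm_num)
    rw [show 2 ^ (j + 1) * n = 2 * (2 ^ j * n) by ring]
    omega

theorem complexity_three_pow_mul_le {n : ℕ} (hn : 0 < n) (j : ℕ) :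
    complexity (3 ^ j * n) ≤ 3 * j + complexity n := by
  induction j with
  | zero => simp
  | succ j ih =>
    have h1 := complexity_mul_le (m := 3) (n := 3 ^ j * n) (by norm_num) (by positivity)
    have h2 := complexity_le_self (n := 3) (by norm_num)
    rw [show 3 ^ (j + 1) * n = 3 * (3 ^ j * n) by ring]
    omega

theorem Core.complexity_le {c i : ℕ} (h : Core c i) : complexity c ≤ i := by
  have h5 := h.five_le
  have h1 := complexity_add_le (maxValue_pos (i - 1)) one_pos
  have h2 := complexity_maxValue_le (k := i - 1) (by omega)
  have h3 := complexity_one_le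
  rw [h.pred]
  omega

/-- Listed numbers other than `1` are prime to `3` and lie above `E (i - 1)`. -/
theorem Listed.spec {c i : ℕ} (h : Listed c i) (hc : c ≠ 1) :
    0 < c ∧ ¬ 3 ∣ c ∧ 2 ≤ i ∧ complexity c ≤ i ∧ maxValue (i - 1) ≤ c := by
  have h23 : ∀ j, ¬ 3 ∣ 2 ^ j := fun j hj =>
    absurd (Nat.prime_three.dvd_of_dvd_pow hj) (by norm_num)
  have hdvd : ∀ j d, ¬ 3 ∣ d → ¬ 3 ∣ 2 ^ j * d := fun j d hd hj =>
    (Nat.prime_three.dvd_mul.1 hj).elim (h23 j) hd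
  cases h with
  | pow j hj =>
    have hj1 : 1 ≤ j := Nat.one_le_iff_ne_zero.2 fun h0 => hc (by rw [h0, pow_zero])
    refine ⟨by positivity, h23 j, by omega, ?_, by interval_cases j <;> decide⟩
    obtain ⟨j, rfl⟩ := Nat.exists_eq_add_of_le' hj1
    have h1 := complexity_two_pow_mul_le (n := 2) (by norm_num) j
    have h2 := complexity_le_self (n := 2) (by norm_num)
    rw [pow_succ]
    omega
  | two_mul j m hj =>
    refine ⟨by positivity, hdvd _ _ (by rw [pow_succ]; omega), by omega, ?_, ?_⟩
    · exact (complexity_two_pow_mul_le (by positivity) j).trans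
        (Nat.add_le_add_left (Core.two_mul m).complexity_le _)
    · interval_cases j
      · rw [show 2 * 0 + (3 * m + 6) - 1 = 3 * (m + 1) + 2 by omega, maxValue_three_mul_add_two]
        omega
      · rw [show 2 * 1 + (3 * m + 6) - 1 = 3 * (m + 1) + 4 by omega, maxValue_three_mul_add_four]
        omega
  | four_mul m =>
    refine ⟨by positivity, ?_, by omega, (Core.four_mul m).complexity_le, ?_⟩
    · rcases m with _ | m
      · norm_num
      · rw [pow_succ]
        omega
    · have := (Core.four_mul m).pred
      omega
  | one_mul j m hj =>
    refine ⟨by positivity, hdvd _ _ (by rw [pow_succ]; omega), by omega, ?_, ?_⟩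
    · exact (complexity_two_pow_mul_le (by positivity) j).trans
        (Nat.add_le_add_left (Core.one_mul m).complexity_le _)
    · interval_cases j
      · rw [show 2 * 0 + (3 * m + 7) - 1 = 3 * (m + 2) by omega, maxValue_three_mul]
        omega
      · rw [show 2 * 1 + (3 * m + 7) - 1 = 3 * (m + 2) + 2 by omega, maxValue_three_mul_add_two]
        omega
      · rw [show 2 * 2 + (3 * m + 7) - 1 = 3 * (m + 2) + 4 by omega, maxValue_three_mul_add_four]
        omega

theorem D_three_pow_le_one (b : ℕ) : D (3 ^ b) ≤ 1 := by
  rcases b with _ | b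
  · exact D_le_one_of_maxValue_le (k := 0) one_pos complexity_one_le le_rfl
  · have h1 := complexity_maxValue_le (k := 3 * (b + 1)) (by omega)
    rw [maxValue_three_mul] at h1
    refine D_le_one_of_maxValue_le (k := 3 * (b + 1)) (by positivity) (by omega) ?_
    rw [maxValue_three_mul]

theorem Listed.D_le_one {c i : ℕ} (h : Listed c i) (b : ℕ) : D (3 ^ b * c) ≤ 1 := by
  by_cases hc : c = 1
  · rw [hc, mul_one]
    exact D_three_pow_le_one b
  · obtain ⟨hpos, -, hi, hle, hlow⟩ := h.spec hc
    have h1 := complexity_three_pow_mul_le hpos b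
    refine D_le_one_of_maxValue_le (k := i - 1 + 3 * b) (by positivity) (by omega) ?_
    -- Here `i - 1 = 1` is the index at which the recursion by `3` fails, so `E (3 * b + 4) = 4 * 3
    -- ^ b` is compared directly.
    by_cases hi2 : i = 2
    · subst hi2
      have hc2 : 2 ≤ c := by omega
      rcases b with _ | b
      · simpa using hlow
      · rw [show 2 - 1 + 3 * (b + 1) = 3 * b + 4 by omega, maxValue_three_mul_add_four, pow_succ]
        nlinarith [Nat.one_le_pow b 3 (by norm_num)]
    · rw [maxValue_add_three_mul (by omega)]
      exact Nat.mul_le_mul_left _ hlow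

/-- As `3` does not divide `c`, the power `3 ^ l` cancels entirely against `3 ^ s`. -/
theorem Listed.D_le_one_of_mul_eq {c i l s n : ℕ} (h : Listed c i)
    (heq : 3 ^ l * n = 3 ^ s * c) : D n ≤ 1 := by
  have h3 : ¬ 3 ∣ c := by
    by_cases hc : c = 1
    · rw [hc]
      norm_num
    · exact (h.spec hc).2.1
  have hls : l ≤ s := by
    by_contra! hlt
    obtain ⟨t, rfl⟩ := Nat.exists_eq_add_of_lt hlt
    rw [show 3 ^ (s + t + 1) * n = 3 ^ s * (3 * (3 ^ t * n)) by ring] at heq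
    exact h3 ⟨_, (Nat.eq_of_mul_eq_mul_left (by positivity) heq).symm⟩
  obtain ⟨t, rfl⟩ := Nat.exists_eq_add_of_le hls
  rw [pow_add, mul_assoc] at heq
  rw [Nat.eq_of_mul_eq_mul_left (by positivity) heq]
  exact h.D_le_one t

/-! ### The tables -/

theorem table0_family_even (t : ℕ) :
    table0 (2 * t + 11) = (2 / 3 + 2 / 3 ^ (t + 6), 3 * (t + 6)) := by
  simp only [table0]
  rw [if_pos (by omega), show 2 * t / 2 = t by omega]

theorem table0_family_odd (t : ℕ) :
    table0 (2 * t + 12) = (2 / 3 + 1 / 3 ^ (t + 6), 3 * (t + 6)) := by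
  simp only [table0]
  rw [if_neg (by omega), show (2 * t + 1) / 2 = t by omega]

theorem table2_family_zero (t : ℕ) :
    table2 (3 * t + 15) = (2 / 3 + 2 / 3 ^ (t + 6), 3 * (t + 6) + 2) := by
  simp only [table2]
  rw [if_pos (by omega), show 3 * t / 3 = t by omega]

theorem table2_family_one (t : ℕ) :
    table2 (3 * t + 16) = (2 / 3 + 1 / (2 * 3 ^ (t + 5)), 3 * (t + 6) + 2) := by
  simp only [table2]
  rw [if_neg (by omega), if_pos (by omega), show (3 * t + 1) / 3 = t by omega]

theorem table2_family_two (t : ℕ) :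
    table2 (3 * t + 17) = (2 / 3 + 1 / 3 ^ (t + 6), 3 * (t + 6) + 2) := by
  simp only [table2]
  rw [if_neg (by omega), if_neg (by omega), show (3 * t + 2) / 3 = t by omega]

/-- `x` is a power of `3` times a listed number. -/
def IsListed (x : ℚ) : Prop :=
  ∃ c i s : ℕ, Listed c i ∧ x = 3 ^ s * c

/-- The threshold makes `h * E k` an integer. Where it exceeds what integrality needs, the surplus
threes are the shift of `s`. -/
theorem isListed_table0 (r q : ℕ) (hq : (table0 r).2 ≤ 3 * q) :
    IsListed ((table0 r).1 * 3 ^ q) := by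
  match r, hq with
  | 0, hq =>
    obtain ⟨s, rfl⟩ := Nat.exists_eq_add_of_le' (show 1 ≤ q by simp only [table0] at hq; omega)
    exact ⟨_, _, s + 1, .pow 0 (by norm_num), by simp only [table0]; push_cast; ring⟩
  | 1, hq =>
    obtain ⟨s, rfl⟩ := Nat.exists_eq_add_of_le' (show 2 ≤ q by simp only [table0] at hq; omega)
    exact ⟨_, _, s, .pow 3 (by norm_num), by simp only [table0]; push_cast; ring⟩
  | 2, hq =>
    obtain ⟨s, rfl⟩ := Nat.exists_eq_add_of_le' (show 4 ≤ q by simp only [table0] at hq; omega)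
    exact ⟨_, _, s, .pow 6 (by norm_num), by simp only [table0]; push_cast; ring⟩
  | 3, hq =>
    obtain ⟨s, rfl⟩ := Nat.exists_eq_add_of_le' (show 4 ≤ q by simp only [table0] at hq; omega)
    exact ⟨_, _, s + 2, .two_mul 0 0 (by norm_num), by simp only [table0]; push_cast; ring⟩
  | 4, hq =>
    obtain ⟨s, rfl⟩ := Nat.exists_eq_add_of_le' (show 4 ≤ q by simp only [table0] at hq; omega)
    exact ⟨_, _, s + 1, .one_mul 1 0 (by norm_num), by simp only [table0]; push_cast; ring⟩
  | 5, hq =>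
    obtain ⟨s, rfl⟩ := Nat.exists_eq_add_of_le' (show 4 ≤ q by simp only [table0] at hq; omega)
    exact ⟨_, _, s + 1, .two_mul 0 1 (by norm_num), by simp only [table0]; push_cast; ring⟩
  | 6, hq =>
    obtain ⟨s, rfl⟩ := Nat.exists_eq_add_of_le' (show 6 ≤ q by simp only [table0] at hq; omega)
    exact ⟨_, _, s, .pow 9 (by norm_num), by simp only [table0]; push_cast; ring⟩
  | 7, hq =>
    obtain ⟨s, rfl⟩ := Nat.exists_eq_add_of_le' (show 6 ≤ q by simp only [table0] at hq; omega)
    exact ⟨_, _, s + 2, .one_mul 1 1 (by norm_num), by simp only [table0]; push_cast; ring⟩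
  | 8, hq =>
    obtain ⟨s, rfl⟩ := Nat.exists_eq_add_of_le' (show 6 ≤ q by simp only [table0] at hq; omega)
    exact ⟨_, _, s + 2, .two_mul 0 2 (by norm_num), by simp only [table0]; push_cast; ring⟩
  | 9, hq =>
    obtain ⟨s, rfl⟩ := Nat.exists_eq_add_of_le' (show 6 ≤ q by simp only [table0] at hq; omega)
    exact ⟨_, _, s + 1, .one_mul 1 2 (by norm_num), by simp only [table0]; push_cast; ring⟩
  | 10, hq =>
    obtain ⟨s, rfl⟩ := Nat.exists_eq_add_of_le' (show 6 ≤ q by simp only [table0] at hq; omega)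
    exact ⟨_, _, s + 1, .two_mul 0 3 (by norm_num), by simp only [table0]; push_cast; ring⟩
  | r + 11, hq =>
    -- With `m = t + 6`, the coefficients are `2 * (3 ^ (m - 1) + 1) / 3 ^ m` and `(2 * 3 ^ (m - 1)
    -- + 1) / 3 ^ m`.
    obtain ⟨t, rfl | rfl⟩ : ∃ t, r = 2 * t ∨ r = 2 * t + 1 := ⟨r / 2, by omega⟩
    · rw [table0_family_even t] at hq ⊢
      obtain ⟨s, rfl⟩ := Nat.exists_eq_add_of_le' (show t + 6 ≤ q by simpa using hq)
      exact ⟨_, _, s, .one_mul 1 (t + 3) (by norm_num), by push_cast; field_simp; ring⟩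
    · rw [table0_family_odd t] at hq ⊢
      obtain ⟨s, rfl⟩ := Nat.exists_eq_add_of_le' (show t + 6 ≤ q by simpa using hq)
      exact ⟨_, _, s, .two_mul 0 (t + 4) (by norm_num), by push_cast; field_simp; ring⟩

theorem isListed_table1 (r q : ℕ) (hq : (table1 r).2 ≤ 3 * q + 4) :
    IsListed ((table1 r).1 * (4 * 3 ^ q)) := by
  match r, hq with
  | 0, hq =>
    exact ⟨_, _, q, .pow 2 (by norm_num), by simp only [table1]; push_cast; ring⟩
  | 1, hq =>
    obtain ⟨s, rfl⟩ := Nat.exists_eq_add_of_le' (show 2 ≤ q by simp only [table1] at hq; omega)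
    exact ⟨_, _, s, .pow 5 (by norm_num), by simp only [table1]; push_cast; ring⟩
  | 2, hq =>
    obtain ⟨s, rfl⟩ := Nat.exists_eq_add_of_le' (show 2 ≤ q by simp only [table1] at hq; omega)
    exact ⟨_, _, s + 1, .one_mul 0 0 (by norm_num), by simp only [table1]; push_cast; ring⟩
  | 3, hq =>
    obtain ⟨s, rfl⟩ := Nat.exists_eq_add_of_le' (show 4 ≤ q by simp only [table1] at hq; omega)
    exact ⟨_, _, s, .pow 8 (by norm_num), by simp only [table1]; push_cast; ring⟩
  | 4, hq =>
    obtain ⟨s, rfl⟩ := Nat.exists_eq_add_of_le' (show 4 ≤ q by simp only [table1] at hq; omega)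
    exact ⟨_, _, s + 2, .one_mul 0 1 (by norm_num), by simp only [table1]; push_cast; ring⟩
  | 5, hq =>
    obtain ⟨s, rfl⟩ := Nat.exists_eq_add_of_le' (show 4 ≤ q by simp only [table1] at hq; omega)
    exact ⟨_, _, s + 1, .one_mul 0 2 (by norm_num), by simp only [table1]; push_cast; ring⟩
  | r + 6, hq =>
    simp only [table1] at hq ⊢
    -- With `m = r + 4`, four times the coefficient is `(3 ^ (m + 1) + 1) / 3 ^ m`.
    obtain ⟨s, rfl⟩ := Nat.exists_eq_add_of_le' (show r + 4 ≤ q by omega)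
    exact ⟨_, _, s, .one_mul 0 (r + 3) (by norm_num), by push_cast; field_simp; ring⟩

theorem isListed_table2 (r q : ℕ) (hq : (table2 r).2 ≤ 3 * q + 2) :
    IsListed ((table2 r).1 * (2 * 3 ^ q)) := by
  match r, hq with
  | 0, hq =>
    exact ⟨_, _, q, .pow 1 (by norm_num), by simp only [table2]; push_cast; ring⟩
  | 1, hq =>
    obtain ⟨s, rfl⟩ := Nat.exists_eq_add_of_le' (show 2 ≤ q by simp only [table2] at hq; omega)
    exact ⟨_, _, s, .pow 4 (by norm_num), by simp only [table2]; push_cast; ring⟩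
  | 2, hq =>
    obtain ⟨s, rfl⟩ := Nat.exists_eq_add_of_le' (show 2 ≤ q by simp only [table2] at hq; omega)
    exact ⟨_, _, s + 1, .four_mul 0, by simp only [table2]; push_cast; ring⟩
  | 3, hq =>
    obtain ⟨s, rfl⟩ := Nat.exists_eq_add_of_le' (show 4 ≤ q by simp only [table2] at hq; omega)
    exact ⟨_, _, s, .pow 7 (by norm_num), by simp only [table2]; push_cast; ring⟩
  | 4, hq =>
    obtain ⟨s, rfl⟩ := Nat.exists_eq_add_of_le' (show 4 ≤ q by simp only [table2] at hq; omega)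
    exact ⟨_, _, s + 2, .two_mul 1 0 (by norm_num), by simp only [table2]; push_cast; ring⟩
  | 5, hq =>
    obtain ⟨s, rfl⟩ := Nat.exists_eq_add_of_le' (show 4 ≤ q by simp only [table2] at hq; omega)
    exact ⟨_, _, s + 1, .one_mul 2 0 (by norm_num), by simp only [table2]; push_cast; ring⟩
  | 6, hq =>
    obtain ⟨s, rfl⟩ := Nat.exists_eq_add_of_le' (show 4 ≤ q by simp only [table2] at hq; omega)
    exact ⟨_, _, s + 2, .four_mul 1, by simp only [table2]; push_cast; ring⟩
  | 7, hq =>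
    obtain ⟨s, rfl⟩ := Nat.exists_eq_add_of_le' (show 4 ≤ q by simp only [table2] at hq; omega)
    exact ⟨_, _, s + 1, .two_mul 1 1 (by norm_num), by simp only [table2]; push_cast; ring⟩
  | 8, hq =>
    obtain ⟨s, rfl⟩ := Nat.exists_eq_add_of_le' (show 6 ≤ q by simp only [table2] at hq; omega)
    exact ⟨_, _, s, .pow 10 (by norm_num), by simp only [table2]; push_cast; ring⟩
  | 9, hq =>
    obtain ⟨s, rfl⟩ := Nat.exists_eq_add_of_le' (show 6 ≤ q by simp only [table2] at hq; omega)
    exact ⟨_, _, s + 2, .one_mul 2 1 (by norm_num), by simp only [table2]; push_cast; ring⟩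
  | 10, hq =>
    obtain ⟨s, rfl⟩ := Nat.exists_eq_add_of_le' (show 6 ≤ q by simp only [table2] at hq; omega)
    exact ⟨_, _, s + 3, .four_mul 2, by simp only [table2]; push_cast; ring⟩
  | 11, hq =>
    obtain ⟨s, rfl⟩ := Nat.exists_eq_add_of_le' (show 6 ≤ q by simp only [table2] at hq; omega)
    exact ⟨_, _, s + 2, .two_mul 1 2 (by norm_num), by simp only [table2]; push_cast; ring⟩
  | 12, hq =>
    obtain ⟨s, rfl⟩ := Nat.exists_eq_add_of_le' (show 6 ≤ q by simp only [table2] at hq; omega)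
    exact ⟨_, _, s + 1, .one_mul 2 2 (by norm_num), by simp only [table2]; push_cast; ring⟩
  | 13, hq =>
    obtain ⟨s, rfl⟩ := Nat.exists_eq_add_of_le' (show 6 ≤ q by simp only [table2] at hq; omega)
    exact ⟨_, _, s + 2, .four_mul 3, by simp only [table2]; push_cast; ring⟩
  | 14, hq =>
    obtain ⟨s, rfl⟩ := Nat.exists_eq_add_of_le' (show 6 ≤ q by simp only [table2] at hq; omega)
    exact ⟨_, _, s + 1, .two_mul 1 3 (by norm_num), by simp only [table2]; push_cast; ring⟩
  | r + 15, hq =>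
    -- With `m = t + 6`, twice the coefficient is `4 * (3 ^ (m - 1) + 1) / 3 ^ m`, `(4 * 3 ^ (m - 2)
    -- + 1) / 3 ^ (m - 1)` or `2 * (2 * 3 ^ (m - 1) + 1) / 3 ^ m`.
    obtain ⟨t, rfl | rfl | rfl⟩ : ∃ t, r = 3 * t ∨ r = 3 * t + 1 ∨ r = 3 * t + 2 :=
      ⟨r / 3, by omega⟩
    · rw [table2_family_zero t] at hq ⊢
      obtain ⟨s, rfl⟩ := Nat.exists_eq_add_of_le' (show t + 6 ≤ q by simpa using hq)
      exact ⟨_, _, s, .one_mul 2 (t + 3) (by norm_num), by push_cast; field_simp; ring⟩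
    · rw [table2_family_one t] at hq ⊢
      obtain ⟨s, rfl⟩ := Nat.exists_eq_add_of_le' (show t + 6 ≤ q by simpa using hq)
      exact ⟨_, _, s + 1, .four_mul (t + 4), by push_cast; field_simp; ring⟩
    · rw [table2_family_two t] at hq ⊢
      obtain ⟨s, rfl⟩ := Nat.exists_eq_add_of_le' (show t + 6 ≤ q by simpa using hq)
      exact ⟨_, _, s, .two_mul 1 (t + 4) (by norm_num), by push_cast; field_simp; ring⟩

theorem isListed_row {r k : ℕ} (hk : 1 ≤ k) (hK : K r k ≤ k) : IsListed (h r k * E k) := by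
  rw [E_eq_maxValue hk]
  unfold K tableRow at hK
  unfold h tableRow
  obtain ⟨q, rfl | rfl | rfl⟩ : ∃ q, k = 3 * q ∨ k = 3 * q + 1 ∨ k = 3 * q + 2 :=
    ⟨k / 3, by omega⟩
  · rw [if_pos (by omega)] at hK ⊢
    rw [maxValue_three_mul]
    exact_mod_cast isListed_table0 r q hK
  · rw [if_neg (by omega), if_pos (by omega)] at hK ⊢
    rcases q with _ | q
    -- No row applies to `k = 1`, since all thresholds in this class are at least `4`.
    · have h4 : 4 ≤ (table1 r).2 := by
        match r with
        | 0 | 1 | 2 | 3 | 4 | 5 => decide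
        | r + 6 => exact Nat.le_add_left _ _
      omega
    · rw [show 3 * (q + 1) + 1 = 3 * q + 4 by ring] at hK ⊢
      rw [maxValue_three_mul_add_four]
      exact_mod_cast isListed_table1 r q hK
  · rw [if_neg (by omega), if_neg (by omega)] at hK ⊢
    rw [maxValue_three_mul_add_two]
    exact_mod_cast isListed_table2 r q hK

/-! ### Every listed number comes from a row. -/

/-- Up to a power of `3`, `c` is given by a row of the tables. -/
def HasRow (c : ℕ) : Prop :=
  ∃ l k r : ℕ, 2 ≤ k ∧ K r k ≤ k ∧ (3 : ℚ) ^ l * c = h r k * E k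

/-- Raising `k` by `3` keeps the row and triples `E k`; the latter fails at `k = 1`, hence the bound
`2 ≤ k` in `HasRow`. -/
theorem HasRow.three_pow_mul {c : ℕ} (hc : HasRow c) (b : ℕ) : HasRow (3 ^ b * c) := by
  obtain ⟨l, k, r, hk, hK, heq⟩ := hc
  have hmod : tableRow r (k + 3 * b) = tableRow r k := by
    simp [tableRow]
  refine ⟨l, k + 3 * b, r, by omega, ?_, ?_⟩
  · unfold K at hK ⊢
    rw [hmod]
    omega
  · rw [E_eq_maxValue (by omega)] at heq ⊢
    rw [maxValue_add_three_mul (by omega)]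
    unfold h at heq ⊢
    rw [hmod]
    push_cast
    linear_combination (3 : ℚ) ^ b * heq

theorem hasRow_of_table0 {c : ℕ} (r q l : ℕ) (hq : 1 ≤ q) (hK : (table0 r).2 ≤ 3 * q)
    (heq : (3 : ℚ) ^ l * c = (table0 r).1 * 3 ^ q) : HasRow c := by
  refine ⟨l, 3 * q, r, by omega, ?_, ?_⟩
  · rwa [K, tableRow, if_pos (by omega)]
  · rw [h, tableRow, if_pos (by omega), E_eq_maxValue (by omega), maxValue_three_mul]
    exact_mod_cast heq

theorem hasRow_of_table1 {c : ℕ} (r q l : ℕ) (hK : (table1 r).2 ≤ 3 * q + 4)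
    (heq : (3 : ℚ) ^ l * c = (table1 r).1 * (4 * 3 ^ q)) : HasRow c := by
  refine ⟨l, 3 * q + 4, r, by omega, ?_, ?_⟩
  · rwa [K, tableRow, if_neg (by omega), if_pos (by omega)]
  · rw [h, tableRow, if_neg (by omega), if_pos (by omega), E_eq_maxValue (by omega),
      maxValue_three_mul_add_four]
    exact_mod_cast heq

theorem hasRow_of_table2 {c : ℕ} (r q l : ℕ) (hK : (table2 r).2 ≤ 3 * q + 2)
    (heq : (3 : ℚ) ^ l * c = (table2 r).1 * (2 * 3 ^ q)) : HasRow c := by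
  refine ⟨l, 3 * q + 2, r, by omega, ?_, ?_⟩
  · rwa [K, tableRow, if_neg (by omega), if_neg (by omega)]
  · rw [h, tableRow, if_neg (by omega), if_neg (by omega), E_eq_maxValue (by omega),
      maxValue_three_mul_add_two]
    exact_mod_cast heq

theorem hasRow_two_pow {j : ℕ} (hj : j ≤ 10) : HasRow (2 ^ j) := by
  interval_cases j
  · exact hasRow_of_table0 0 1 1 (by norm_num) (by decide) (by norm_num [table0])
  · exact hasRow_of_table2 0 0 0 (by decide) (by norm_num [table2])
  · exact hasRow_of_table1 0 0 0 (by decide) (by norm_num [table1])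
  · exact hasRow_of_table0 1 2 0 (by norm_num) (by decide) (by norm_num [table0])
  · exact hasRow_of_table2 1 2 0 (by decide) (by norm_num [table2])
  · exact hasRow_of_table1 1 2 0 (by decide) (by norm_num [table1])
  · exact hasRow_of_table0 2 4 0 (by norm_num) (by decide) (by norm_num [table0])
  · exact hasRow_of_table2 3 4 0 (by decide) (by norm_num [table2])
  · exact hasRow_of_table1 3 4 0 (by decide) (by norm_num [table1])
  · exact hasRow_of_table0 6 6 0 (by norm_num) (by decide) (by norm_num [table0])
  · exact hasRow_of_table2 8 6 0 (by decide) (by norm_num [table2])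

/-- The small cases are the sporadic rows. Their exponent `l` supplies the threes needed to reach
the threshold: `3 ^ 2 * 7 = 7 / 9 * 3 ^ 4`. -/
theorem hasRow_two_mul_three_pow_add_one (m : ℕ) : HasRow (2 ^ 0 * (2 * 3 ^ (m + 1) + 1)) := by
  match m with
  | 0 => exact hasRow_of_table0 3 4 2 (by norm_num) (by decide) (by norm_num [table0])
  | 1 => exact hasRow_of_table0 5 4 1 (by norm_num) (by decide) (by norm_num [table0])
  | 2 => exact hasRow_of_table0 8 6 2 (by norm_num) (by decide) (by norm_num [table0])
  | 3 => exact hasRow_of_table0 10 6 1 (by norm_num) (by decide) (by norm_num [table0])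
  | t + 4 =>
    exact hasRow_of_table0 (2 * t + 12) (t + 6) 0 (by omega) (by rw [table0_family_odd])
      (by rw [table0_family_odd]; push_cast; field_simp; ring)

theorem hasRow_four_mul_three_pow_add_two (m : ℕ) : HasRow (2 ^ 1 * (2 * 3 ^ (m + 1) + 1)) := by
  match m with
  | 0 => exact hasRow_of_table2 4 4 2 (by decide) (by norm_num [table2])
  | 1 => exact hasRow_of_table2 7 4 1 (by decide) (by norm_num [table2])
  | 2 => exact hasRow_of_table2 11 6 2 (by decide) (by norm_num [table2])
  | 3 => exact hasRow_of_table2 14 6 1 (by decide) (by norm_num [table2])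
  | t + 4 =>
    exact hasRow_of_table2 (3 * t + 17) (t + 6) 0 (by rw [table2_family_two])
      (by rw [table2_family_two]; push_cast; field_simp; ring)

theorem hasRow_four_mul_three_pow_add_one (m : ℕ) : HasRow (4 * 3 ^ m + 1) := by
  match m with
  | 0 => exact hasRow_of_table2 2 2 1 (by decide) (by norm_num [table2])
  | 1 => exact hasRow_of_table2 6 4 2 (by decide) (by norm_num [table2])
  | 2 => exact hasRow_of_table2 10 6 3 (by decide) (by norm_num [table2])
  | 3 => exact hasRow_of_table2 13 6 2 (by decide) (by norm_num [table2])
  | t + 4 =>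
    exact hasRow_of_table2 (3 * t + 16) (t + 6) 1 (by rw [table2_family_one])
      (by rw [table2_family_one]; push_cast; field_simp; ring)

theorem hasRow_three_pow_add_one (m : ℕ) : HasRow (2 ^ 0 * (3 ^ (m + 2) + 1)) := by
  match m with
  | 0 => exact hasRow_of_table1 2 2 1 (by decide) (by norm_num [table1])
  | 1 => exact hasRow_of_table1 4 4 2 (by decide) (by norm_num [table1])
  | 2 => exact hasRow_of_table1 5 4 1 (by decide) (by norm_num [table1])
  | t + 3 =>
    exact hasRow_of_table1 (t + 6) (t + 4) 0 (by rw [table1])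
      (by rw [table1]; push_cast; field_simp; ring)

theorem hasRow_two_mul_three_pow_add_two (m : ℕ) : HasRow (2 ^ 1 * (3 ^ (m + 2) + 1)) := by
  match m with
  | 0 => exact hasRow_of_table0 4 4 1 (by norm_num) (by decide) (by norm_num [table0])
  | 1 => exact hasRow_of_table0 7 6 2 (by norm_num) (by decide) (by norm_num [table0])
  | 2 => exact hasRow_of_table0 9 6 1 (by norm_num) (by decide) (by norm_num [table0])
  | t + 3 =>
    exact hasRow_of_table0 (2 * t + 11) (t + 6) 0 (by omega) (by rw [table0_family_even])
      (by rw [table0_family_even]; push_cast; field_simp; ring)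

theorem hasRow_four_mul_three_pow_add_four (m : ℕ) : HasRow (2 ^ 2 * (3 ^ (m + 2) + 1)) := by
  match m with
  | 0 => exact hasRow_of_table2 5 4 1 (by decide) (by norm_num [table2])
  | 1 => exact hasRow_of_table2 9 6 2 (by decide) (by norm_num [table2])
  | 2 => exact hasRow_of_table2 12 6 1 (by decide) (by norm_num [table2])
  | t + 3 =>
    exact hasRow_of_table2 (3 * t + 15) (t + 6) 0 (by rw [table2_family_zero])
      (by rw [table2_family_zero]; push_cast; field_simp; ring)

/-- The residue of `i` modulo `3` decides which table holds `c`. -/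
theorem Listed.hasRow {c i : ℕ} (hc : Listed c i) : HasRow c := by
  cases hc with
  | pow j hj => exact hasRow_two_pow hj
  | two_mul j m hj =>
    interval_cases j
    · exact hasRow_two_mul_three_pow_add_one m
    · exact hasRow_four_mul_three_pow_add_two m
  | four_mul m => exact hasRow_four_mul_three_pow_add_one m
  | one_mul j m hj =>
    interval_cases j
    · exact hasRow_three_pow_add_one m
    · exact hasRow_two_mul_three_pow_add_two m
    · exact hasRow_four_mul_three_pow_add_four m

theorem hasRow_of_D_le_one {n : ℕ} (hn : 0 < n) (hD : D n ≤ 1) : HasRow n := by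
  obtain rfl | hn1 : n = 1 ∨ 1 < n := by omega
  · exact hasRow_two_pow (j := 0) (by norm_num)
  · obtain ⟨h2, hlt⟩ := maxValue_lt_of_D_le_one hn1 hD
    obtain ⟨e, rfl, he⟩ := (isLeast_complexity hn).1
    rw [← he] at h2 hlt
    obtain ⟨c, i, b, hc, hval⟩ := (e.shape h2 hlt).exists_listed h2 hlt
    rw [hval]
    exact hc.hasRow.three_pow_mul b

end IntegerComplexity

theorem mainTheorem10 (n : ℕ) (hn : 0 < n) :
    IntegerComplexity.D n ≤ 1 ↔
      ∃ l k r : ℕ, 1 ≤ k ∧ IntegerComplexity.K r k ≤ k ∧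
        (3 : ℚ) ^ l * (n : ℚ) = IntegerComplexity.h r k * (IntegerComplexity.E k : ℚ) := by
  constructor
  · intro hD
    obtain ⟨l, k, r, hk, hK, heq⟩ := IntegerComplexity.hasRow_of_D_le_one hn hD
    exact ⟨l, k, r, by omega, hK, heq⟩
  · rintro ⟨l, k, r, hk, hK, heq⟩
    obtain ⟨c, i, s, hc, hx⟩ := IntegerComplexity.isListed_row hk hK
    exact hc.D_le_one_of_mul_eq (l := l) (s := s) (by exact_mod_cast heq.trans hx)
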